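/- Let $K$ be a field. A subset $\mathcal O\subseteq K$ belongs to $\mathcal B(K)$ if $\mathcal O\cdot\mathcal O\subseteq\mathcal O$ and $\mathcal O\cup\mathcal O^{-1}=K$, where $\mathcal O^{-1}=\{x^{-1}:0\neq x\in\mathcal O\}$; put $\mathcal O^\times=\mathcal O\cap\mathcal O^{-1}$ and $\mathfrak m_{\mathcal O}=\mathcal O\setminus\mathcal O^\times$. Let $S(K)$ be the set of localities of $K$, i.e. of equivalence classes of (Krull) valuations, orderings, and equivalence classes of absolute values on $K$, where a locality $v$ is identified with its unit ball $\mathcal O_v\in\mathcal B(K)$, which is $\{v(x)\ge 0\}$, $\{-1\le_v x\le_v 1\}$ or $\{|x|_v\le 1\}$ respectively; write $\mathfrak m_v=\mathfrak m_{\mathcal O_v}$. On $S(K)$ let $\mathcal T_{\rm Zar}$ be the topology with subbasis the sets $\{v: x\in\mathcal O_v\}$ ($x\in K$), and $\mathcal T_{\rm Zar^*}$ the topology with subbasis the sets $\{v: x\in\mathfrak m_v\}$ ($x\in K$). If $\mathcal O_v\subseteq\mathcal O_w$, then $v$ is a refinement of $w$ and $w$ a coarsening of $v$; $v\vee w$ denotes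 the finest common coarsening of $v$ and $w$ in $S(K)$. Two localities are incomparable if neither refines the other, and strongly incomparable if moreover they induce distinct localities on the residue field of $v\vee w$ (which is then a valuation). For $t\in K^\times$, two localities $v,w$ are $t$-independent if $t\in\mathcal O_{v\vee w}^\times$ and, in case both are orderings, $v$ and $w$ are strongly incomparable. Two sets of localities are $t$-independent (incomparable) if every element of the first is $t$-independent of (incomparable to) every element of the second. Theorem. Let $S_1,\dots,S_n\subseteq S(K)$, $t\in K^\times$, $x_1,\dots,x_n\in K$ and $z_1,\dots,z_n\in K^\times$. In Situation $\mathfrak m$ write $\mathfrak B_v=\mathfrak m_v$ and give $S(K)$ the topology $\mathcal T_{\rm Zar^*}$; in Situation $\mathcal O$ write $\mathfrak B_v=\mathcal O_v$ and give $S(K)$ the topology $\mathcal T_{\rm Zar}$. In either situation, assume: (U) There is a polynomial $f\in K[X]$ of degree $d\ge 2$ with leading coefficient $a_d$ such that for all $v\in S_1\cup\dots\cup S_n$: (i) $f(x)\in\mathcal O_v$ for all $x\in\mathcal O_v$; (ii) $f(x)\notin t\mathfrak m_v$ for all $x\in\mathcal O_v$; (iii) $f(x)\in x^d(\mathcal O_v\setminus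 t\mathfrak m_v)\cap(a_dx^d+x^{d-1}\mathcal O_v)$ for all $x\in K\setminus\mathcal O_v$; (iv) $\mathcal O_v+\mathcal O_v\subseteq t^{-1}\mathcal O_v$. (T) Each $S_i$ is compact (i.e. quasi-compact) in the given topology. (I) For all $i,j$ and every valuation $w$ on $K$ with a refinement in $S_i$ and a refinement in $S_j$ we have $w(x_i-x_j)\ge w(z_i)=w(z_j)$; the $S_i$ are pairwise $t$-independent; and in Situation $\mathfrak m$ the $S_i$ are moreover pairwise incomparable. Then there exists $x\in K$ with $x-x_i\in z_i\mathfrak B_v$ for all $v\in S_i$ and all $i=1,\dots,n$. -/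

import Mathlib

open scoped Pointwise Polynomial

/-- The set `𝓑(K)` of all subsets `𝒪 ⊆ K` with `𝒪 · 𝒪 ⊆ 𝒪` and `𝒪 ∪ 𝒪⁻¹ = K`,
where `𝒪⁻¹ = {x⁻¹ : 0 ≠ x ∈ 𝒪}`. -/
@[ext]
structure BallSet (K : Type*) [Field K] where
  carrier : Set K
  mul_subset : carrier * carrier ⊆ carrier
  union_inv : carrier ∪ {y | ∃ x ∈ carrier, x ≠ 0 ∧ x⁻¹ = y} = Set.univ

namespace BallSet

variable {K : Type*} [Field K]

theorem mul_mem (O : BallSet K) {x y : K} (hx : x ∈ O.carrier) (hy : y ∈ O.carrier) :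
    x * y ∈ O.carrier :=
  O.mul_subset (Set.mul_mem_mul hx hy)

theorem mem_or_inv_mem (O : BallSet K) (x : K) : x ∈ O.carrier ∨ x⁻¹ ∈ O.carrier := by
  have h : x ∈ O.carrier ∪ {y | ∃ x ∈ O.carrier, x ≠ 0 ∧ x⁻¹ = y} := by
    rw [O.union_inv]; trivial
  rcases h with h | ⟨y, hy, -, rfl⟩
  · exact Or.inl h
  · right; simpa using hy

/-- A practical constructor for elements of `𝓑(K)`. -/
def mk' (s : Set K) (hmul : ∀ x ∈ s, ∀ y ∈ s, x * y ∈ s) (hinv : ∀ x, x ∈ s ∨ x⁻¹ ∈ s) :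
    BallSet K where
  carrier := s
  mul_subset := by
    rintro _ ⟨x, hx, y, hy, rfl⟩
    exact hmul x hx y hy
  union_inv := by
    refine Set.eq_univ_of_forall fun x => ?_
    rcases hinv x with h | h
    · exact Or.inl h
    · by_cases hx : x = 0
      · subst hx; left; simpa using h
      · exact Or.inr ⟨x⁻¹, h, inv_ne_zero hx, inv_inv x⟩

/-- `𝒪^× = 𝒪 ∩ 𝒪⁻¹`. -/
def units (O : BallSet K) : Set K :=
  O.carrier ∩ {y | ∃ x ∈ O.carrier, x ≠ 0 ∧ x⁻¹ = y}

/-- `𝔪_𝒪 = 𝒪 \ 𝒪^×`. -/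
def maximal (O : BallSet K) : Set K :=
  O.carrier \ O.units

variable (K) in
/-- The Zariski topology on `𝓑(K)`, with subbasis the sets `{𝒪 : x ∈ 𝒪}`, `x ∈ K`. -/
abbrev zariski : TopologicalSpace (BallSet K) :=
  TopologicalSpace.generateFrom (Set.range fun x : K => {O : BallSet K | x ∈ O.carrier})

variable (K) in
/-- The Hochster dual of the Zariski topology on `𝓑(K)`, with subbasis the sets
`{𝒪 : x ∈ 𝔪_𝒪}`, `x ∈ K`. -/
abbrev zariskiDual : TopologicalSpace (BallSet K) :=
  TopologicalSpace.generateFrom (Set.range fun x : K => {O : BallSet K | x ∈ O.maximal})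

/-- The element of `𝓑(K)` given by a valuation, i.e. its valuation ring. -/
def ofValuation (A : ValuationSubring K) : BallSet K :=
  mk' (A : Set K) (fun _ hx _ hy => A.mul_mem _ _ hx hy) A.mem_or_inv_mem

/-- The element of `𝓑(K)` given by a field ordering, i.e. `{x : -1 ≤ x ≤ 1}`. -/
def ofOrdering [LinearOrder K] [IsStrictOrderedRing K] : BallSet K :=
  mk' (Set.Icc (-1) 1)
    (fun x hx y hy => by
      have h1 : |x| ≤ 1 := abs_le.2 hx
      have h2 : |y| ≤ 1 := abs_le.2 hy
      refine abs_le.1 ?_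
      rw [abs_mul]
      exact mul_le_one₀ h1 (abs_nonneg y) h2)
    (fun x => by
      by_cases h : |x| ≤ 1
      · exact Or.inl (abs_le.1 h)
      · refine Or.inr (abs_le.1 ?_)
        rw [abs_inv]
        exact inv_le_one_of_one_le₀ (not_le.1 h).le)

/-- The element of `𝓑(K)` given by an absolute value, i.e. `{x : |x| ≤ 1}`. -/
def ofAbs (a : AbsoluteValue K ℝ) : BallSet K :=
  mk' {x | a x ≤ 1}
    (fun x hx y hy => by
      change a (x * y) ≤ 1
      rw [map_mul]
      exact mul_le_one₀ hx (a.nonneg y) hy)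
    (fun x => by
      by_cases h : a x ≤ 1
      · exact Or.inl h
      · right
        change a x⁻¹ ≤ 1
        rw [map_inv₀]
        exact inv_le_one_of_one_le₀ (not_le.1 h).le)

/-- `𝒪` belongs to (the image of) `S_val(K)`. Equivalence classes of Krull valuations are
the same as valuation rings. -/
def IsVal (O : BallSet K) : Prop := ∃ A : ValuationSubring K, O = ofValuation A

/-- `𝒪` belongs to (the image of) `S_ord(K)`. -/
def IsOrd (O : BallSet K) : Prop :=
  ∃ (_ : LinearOrder K) (_ : IsStrictOrderedRing K), O = ofOrdering

/-- `𝒪` belongs to (the image of) `S_abs(K)`. -/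
def IsAbs (O : BallSet K) : Prop := ∃ a : AbsoluteValue K ℝ, O = ofAbs a

/-- If `v ∈ 𝓑(K)` is contained in a valuation ring `A`, the element of `𝓑` of the residue
field of `A` induced by `v`: the image of `𝒪_v` in the residue field. If `v` is a valuation this
is the valuation ring of the induced valuation; if `v` is an ordering, it is the interval
`[-1, 1]` for the induced ordering, since `[-1, 1]_v` maps onto it. -/
noncomputable def induced (v : BallSet K) (A : ValuationSubring K) (h : v.carrier ⊆ (A : Set K)) :
    BallSet (IsLocalRing.ResidueField A) :=
  mk' (IsLocalRing.residue A '' {a : A | (a : K) ∈ v.carrier})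
    (by
      rintro _ ⟨a, ha, rfl⟩ _ ⟨b, hb, rfl⟩
      exact ⟨a * b, v.mul_mem ha hb, map_mul _ _ _⟩)
    (fun y => by
      obtain ⟨a, rfl⟩ := IsLocalRing.residue_surjective y
      rcases v.mem_or_inv_mem (a : K) with ha | ha
      · exact Or.inl ⟨a, ha, rfl⟩
      · by_cases h0 : a = 0
        · subst h0
          left
          exact ⟨0, by simpa using ha, rfl⟩
        · right
          refine ⟨⟨(a : K)⁻¹, h ha⟩, ha, ?_⟩
          refine eq_inv_of_mul_eq_one_left ?_
          rw [← map_mul, ← map_one (IsLocalRing.residue A)]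
          congr 1
          ext
          have : (a : K) ≠ 0 := fun h => h0 (Subtype.ext h)
          simp [this])

end BallSet

/-- The space `S(K)` of localities of `K`: equivalence classes of valuations, orderings, and
equivalence classes of absolute values, each identified with the associated element
`𝒪_v` of `𝓑(K)`. -/
structure Locality (K : Type*) [Field K] where
  ball : BallSet K
  isLocality : ball.IsVal ∨ ball.IsOrd ∨ ball.IsAbs

namespace Locality

variable {K : Type*} [Field K]

/-- The set `𝒪_v`. -/
def unitBall (v : Locality K) : Set K := v.ball.carrier

/-- The set `𝒪_v^×`. -/
def units (v : Locality K) : Set K := v.ball.units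

/-- The set `𝔪_v`. -/
def maximal (v : Locality K) : Set K := v.ball.maximal

theorem ext_unitBall {v w : Locality K} (h : v.unitBall = w.unitBall) : v = w := by
  cases v; cases w; congr; exact BallSet.ext h

/-- The locality of a valuation. -/
def ofValuation (A : ValuationSubring K) : Locality K :=
  ⟨BallSet.ofValuation A, Or.inl ⟨A, rfl⟩⟩

variable (K) in
/-- The Zariski topology on `S(K)`. -/
abbrev zariski : TopologicalSpace (Locality K) :=
  TopologicalSpace.induced ball (BallSet.zariski K)

variable (K) in
/-- The topology on `S(K)` induced by the Hochster dual of the Zariski topology. -/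
abbrev zariskiDual : TopologicalSpace (Locality K) :=
  TopologicalSpace.induced ball (BallSet.zariskiDual K)

/-- `v ≤ w` means that `v` is a refinement of `w`, i.e. that `w` is a coarsening of `v`. -/
instance : PartialOrder (Locality K) where
  le v w := v.unitBall ⊆ w.unitBall
  le_refl v := subset_rfl
  le_trans _ _ _ := subset_trans
  le_antisymm _ _ h h' := ext_unitBall (subset_antisymm h h')

/-! Existence of the finest common coarsening of two localities. -/

theorem one_mem (v : Locality K) : (1 : K) ∈ v.unitBall := by
  rcases v.ball.mem_or_inv_mem 1 with h | h
  · exact h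
  · rw [inv_one] at h
    exact h

theorem pow_mem (v : Locality K) {x : K} (hx : x ∈ v.unitBall) (n : ℕ) : x ^ n ∈ v.unitBall := by
  induction n with
  | zero => simpa using v.one_mem
  | succ k ih => rw [pow_succ]; exact v.ball.mul_mem ih hx

theorem isVal_or_abs {v : Locality K} (h : v.ball.IsAbs) :
    v.ball.IsVal ∨ ∃ a : AbsoluteValue K ℝ, v.unitBall = {x | a x ≤ 1} ∧ ∃ m : ℕ, 1 < a m := by
  obtain ⟨a, ha⟩ := h
  have hr : v.unitBall = {x | a x ≤ 1} := by rw [unitBall, ha]; rfl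
  by_cases hm : ∃ m : ℕ, 1 < a m
  · exact Or.inr ⟨a, hr, hm⟩
  · push Not at hm
    left
    have hna : IsNonarchimedean a := by
      let : NormedField K := a.toNormedField
      have := IsUltrametricDist.isUltrametricDist_of_forall_norm_natCast_le_one
        (R := K) hm
      exact fun x y => IsUltrametricDist.norm_add_le_max x y
    refine ⟨{ carrier := {x | a x ≤ 1}
              mul_mem' := fun {x y} hx hy => (BallSet.ofAbs a).mul_mem hx hy
              one_mem' := by simp
              add_mem' := fun {x y} hx hy => (hna x y).trans (max_le hx hy)
              zero_mem' := by simp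
              neg_mem' := fun {x} hx => by simpa using hx
              mem_or_inv_mem' := fun x => (BallSet.ofAbs a).mem_or_inv_mem x }, ?_⟩
    rw [ha]
    rfl

theorem ofOrdering_one_lt_sq {v : Locality K} (h : v.ball.IsOrd) {y : K} (hy : y ∉ v.unitBall) :
    ∃ d : K, y ^ 2 = 1 + d ∧ d ≠ 0 ∧ 1 + d ≠ 0 ∧ (1 - d) / (1 + d) ∈ v.unitBall ∧
      ∀ n : ℕ, n * d / (1 + d) ^ n ∈ v.unitBall := by
  obtain ⟨_, _, hv⟩ := h
  have hr : v.unitBall = Set.Icc (-1) 1 := by rw [unitBall, hv]; rfl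
  rw [hr] at hy ⊢
  have h1 : 1 < y ^ 2 := by
    rw [one_lt_sq_iff_one_lt_abs]
    by_contra hc
    exact hy (abs_le.1 (not_lt.1 hc))
  obtain ⟨d, hd⟩ : ∃ d, d = y ^ 2 - 1 := ⟨_, rfl⟩
  have hd0 : 0 < d := by rw [hd]; linarith
  have hp : 0 < 1 + d := by linarith
  refine ⟨d, by rw [hd]; ring, hd0.ne', hp.ne', ?_, fun n => ?_⟩
  · constructor
    · rw [le_div_iff₀ hp]; linarith
    · rw [div_le_iff₀ hp]; linarith
  · have hb : 1 + (n : K) * d ≤ (1 + d) ^ n := one_add_mul_le_pow (by linarith) n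
    have hpn : 0 < (1 + d) ^ n := pow_pos hp n
    have hn : 0 ≤ (n : K) * d := mul_nonneg n.cast_nonneg hd0.le
    constructor
    · rw [le_div_iff₀ hpn]; linarith
    · rw [div_le_iff₀ hpn]; linarith

theorem ofOrdering_eq_zero {v : Locality K} (h : v.ball.IsOrd) {d : K} (h1 : 1 + d ∈ v.unitBall)
    (h2 : 1 + d ≠ 0) (h3 : (1 - d) / (1 + d) ∈ v.unitBall) : d = 0 := by
  obtain ⟨_, _, hv⟩ := h
  have hr : v.unitBall = Set.Icc (-1) 1 := by rw [unitBall, hv]; rfl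
  rw [hr] at h1 h3
  have h4 : |(1 - d) / (1 + d)| ≤ 1 := abs_le.2 h3
  rw [abs_div, div_le_one (abs_pos.2 h2)] at h4
  have h5 := sq_le_sq.2 h4
  have := h1.2
  nlinarith

theorem exists_nat_notMem {w : Locality K} (hw : ¬ w.ball.IsVal) : ∃ m : ℕ, (m : K) ∉ w.unitBall := by
  rcases w.isLocality with h | h | h
  · exact absurd h hw
  · obtain ⟨_, _, hv⟩ := h
    have hr : w.unitBall = Set.Icc (-1) 1 := by rw [unitBall, hv]; rfl
    refine ⟨2, ?_⟩
    rw [hr]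
    rintro ⟨-, h⟩
    norm_num at h
  · rcases isVal_or_abs h with h | ⟨a, ha, m, hm⟩
    · exact absurd h hw
    · refine ⟨m, ?_⟩
      rw [ha]
      exact not_le.2 hm

/-- A proper coarsening of a locality is a valuation. -/
theorem isVal_of_lt {v w : Locality K} (h : v < w) : w.ball.IsVal := by
  by_contra hw
  have hle : v.unitBall ⊆ w.unitBall := h.le
  refine absurd h.le (fun _ => h.not_ge fun y hyw => ?_)
  by_contra hyv
  obtain ⟨m, hm⟩ := exists_nat_notMem hw
  rcases v.isLocality with hv | hv | ⟨a, ha⟩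
  · obtain ⟨A, hA⟩ := hv
    have hr : v.unitBall = (A : Set K) := by rw [unitBall, hA]; rfl
    exact hm (hle (by rw [hr]; exact natCast_mem A m))
  · obtain ⟨d, hd, hd0, hd1, hd2, hd3⟩ := ofOrdering_one_lt_sq hv hyv
    have hyw2 : 1 + d ∈ w.unitBall := hd ▸ w.pow_mem hyw 2
    rcases w.isLocality with h' | h' | h'
    · exact hw h'
    · exact hd0 (ofOrdering_eq_zero h' hyw2 hd1 (hle hd2))
    · rcases isVal_or_abs h' with h' | ⟨b, hb, k, hk⟩
      · exact hw h'
      · obtain ⟨e, he⟩ := pow_unbounded_of_one_lt (b d)⁻¹ hk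
        have h1 := w.ball.mul_mem (hle (hd3 (k ^ e))) (w.pow_mem hyw2 (k ^ e))
        rw [div_mul_cancel₀ _ (pow_ne_zero _ hd1)] at h1
        have h2 : b (((k ^ e : ℕ) : K) * d) ≤ 1 := by
          have : ((k ^ e : ℕ) : K) * d ∈ w.unitBall := h1
          rw [hb] at this
          exact this
        rw [map_mul, Nat.cast_pow, map_pow] at h2
        rw [inv_lt_iff_one_lt_mul₀ (b.pos hd0)] at he
        linarith
  · have hr : v.unitBall = {x | a x ≤ 1} := by rw [unitBall, ha]; rfl
    have hy1 : 1 < a y := by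
      rw [hr] at hyv
      exact not_le.1 hyv
    obtain ⟨e, he⟩ := pow_unbounded_of_one_lt (a m) hy1
    have hy0 : y ≠ 0 := by
      rintro rfl
      simp at hy1
      linarith
    have h1 : (m : K) / y ^ e ∈ v.unitBall := by
      rw [hr]
      change a _ ≤ 1
      rw [map_div₀, map_pow, div_le_one (by positivity)]
      exact he.le
    have h2 := w.ball.mul_mem (hle h1) (w.pow_mem hyw e)
    rw [div_mul_cancel₀ _ (pow_ne_zero _ hy0)] at h2
    exact hm h2

/-- Any two localities have a finest common coarsening. -/
theorem exists_isLUB (v w : Locality K) : ∃ u, IsLUB {v, w} u := by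
  by_cases hvw : v ≤ w
  · exact ⟨w, by simpa using hvw, fun u hu => hu (by simp)⟩
  by_cases hwv : w ≤ v
  · exact ⟨v, by simpa using hwv, fun u hu => hu (by simp)⟩
  have chain : ∀ B C : ValuationSubring K, v ≤ ofValuation B → v ≤ ofValuation C →
      ∀ b ∈ B, b ∉ C → ∀ c ∈ C, c ∈ B := by
    intro B C hB hC b hb hbC c hc
    have hb0 : b ≠ 0 := by rintro rfl; exact hbC C.zero_mem
    by_cases hc0 : c = 0
    · subst hc0; exact B.zero_mem
    rcases v.ball.mem_or_inv_mem (c / b) with h | h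
    · have h1 : c / b ∈ B := hB h
      have := B.mul_mem _ _ h1 hb
      rwa [div_mul_cancel₀ _ hb0] at this
    · rw [inv_div] at h
      have h1 : b / c ∈ C := hC h
      have := C.mul_mem _ _ h1 hc
      rw [div_mul_cancel₀ _ hc0] at this
      exact absurd this hbC
  let T : Set (ValuationSubring K) := {B | v ≤ ofValuation B ∧ w ≤ ofValuation B}
  let A : ValuationSubring K :=
    { carrier := {x | ∀ B ∈ T, x ∈ B}
      mul_mem' := fun hx hy B hB => B.mul_mem _ _ (hx B hB) (hy B hB)
      one_mem' := fun B _ => B.one_mem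
      add_mem' := fun hx hy B hB => B.add_mem _ _ (hx B hB) (hy B hB)
      zero_mem' := fun B _ => B.zero_mem
      neg_mem' := fun hx B hB => B.neg_mem _ (hx B hB)
      mem_or_inv_mem' := fun x => by
        by_contra hc
        simp only [Set.mem_ofPred_eq, not_or, not_forall] at hc
        obtain ⟨⟨B, hB, hxB⟩, C, hC, hxC⟩ := hc
        have h1 : x⁻¹ ∈ B := (B.mem_or_inv_mem x).resolve_left hxB
        have h2 : x ∈ C := (C.mem_or_inv_mem x).resolve_right hxC
        exact hxB (chain B C hB.1 hC.1 _ h1 hxC _ h2) }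
  refine ⟨ofValuation A, ?_, fun u hu => ?_⟩
  · rintro u (rfl | rfl)
    · exact fun x hx B hB => hB.1 hx
    · exact fun x hx B hB => hB.2 hx
  · have hvu : v ≤ u := hu (by simp)
    have hwu : w ≤ u := hu (by simp)
    obtain ⟨B, hB⟩ := isVal_of_lt (lt_of_le_of_ne hvu fun h => hwv (h ▸ hwu))
    have hu' : u = ofValuation B := by cases u; subst hB; rfl
    subst hu'
    exact fun x hx => hx B ⟨hvu, hwu⟩

/-- The finest common coarsening `v ∨ w` of two localities. -/
noncomputable def join (v w : Locality K) : Locality K := (exists_isLUB v w).choose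

theorem isLUB_join (v w : Locality K) : IsLUB {v, w} (join v w) := (exists_isLUB v w).choose_spec

theorem le_join_left (v w : Locality K) : v ≤ join v w := (isLUB_join v w).1 (by simp)

theorem le_join_right (v w : Locality K) : w ≤ join v w := (isLUB_join v w).1 (by simp)

/-- Incomparability for the refinement order. -/
def Incomparable (v w : Locality K) : Prop := ¬ v ≤ w ∧ ¬ w ≤ v

/-- `v` and `w` are strongly incomparable: they are incomparable (so that `v ∨ w` is a
valuation) and they induce distinct localities on the residue field of `v ∨ w`. -/
def StronglyIncomparable (v w : Locality K) : Prop :=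
  Incomparable v w ∧ ∃ (A : ValuationSubring K) (hA : join v w = ofValuation A),
    v.ball.induced A (hA ▸ le_join_left v w : v ≤ ofValuation A) ≠
      w.ball.induced A (hA ▸ le_join_right v w : w ≤ ofValuation A)

/-- `t`-independence of two localities. -/
def TIndependent (t : K) (v w : Locality K) : Prop :=
  t ∈ (join v w).units ∧ (v.ball.IsOrd → w.ball.IsOrd → StronglyIncomparable v w)

/-- The uniformity condition on a set `S` of localities and an element `t`: there is a
polynomial `f` of degree `d ≥ 2` such that (i)-(iv) hold for all `v ∈ S`. -/
def Uniformity (S : Set (Locality K)) (t : K) : Prop :=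
  ∃ f : K[X], 2 ≤ f.natDegree ∧ ∀ v ∈ S,
    (∀ x ∈ v.unitBall, f.eval x ∈ v.unitBall) ∧
    (∀ x ∈ v.unitBall, f.eval x ∉ t • v.maximal) ∧
    (∀ x ∉ v.unitBall, f.eval x ∈
      (x ^ f.natDegree • (v.unitBall \ t • v.maximal)) ∩
        ({f.leadingCoeff * x ^ f.natDegree} + x ^ (f.natDegree - 1) • v.unitBall)) ∧
    v.unitBall + v.unitBall ⊆ t⁻¹ • v.unitBall

end Locality

/-! ### Elementary arithmetic in a unit ball. -/

namespace Locality

variable {K : Type*} [Field K]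

/-! The polynomial `f` replaces a norm, uniformly in all given localities: up to factors `t`, `f(x)`
has size `max(1, |x|) ^ d`. Three constructions use this: `f(x) / t` dominates `1` and `x`
everywhere (`exists_dominating`), the homogenisation `y ^ d * f(x / y)` is an approximate maximum
(`exists_max`), and `a_d * e ^ d / f(e)` is a cutoff, near `1` where `e` is large and near `0` where
`e` is small (`exists_cutoff`).

Independence enters through `TIndependent.exists_valuationSubring`: the set `𝒪_v · 𝒪_w` is a
valuation ring `A` containing `t⁻¹`. So each nonzero `c ∈ A` factors into an element small at `v`
and one small at `w`; for incomparable `v`, `w` both factors can be taken in the maximal parts.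
Compactness and approximate maxima turn these pointwise factorisations into one valid on whole sets
(`exists_separating`, `exists_large`). Condition (I), applied to `A`, ensures that the elements to
be factored lie in `A`.

Finally, induct on the number of sets: if `b` solves the problem away from `S j`, then `b + g * (x j
- b)` solves it everywhere for a cutoff `g` near `1` on `S j` and near `0` on the others. Powers of
`t` pay for addition, which respects balls only up to `t`. -/

theorem mul_mem (v : Locality K) {x y : K} (hx : x ∈ v.unitBall) (hy : y ∈ v.unitBall) :
    x * y ∈ v.unitBall :=
  v.ball.mul_mem hx hy

theorem mem_or_inv_mem (v : Locality K) (x : K) : x ∈ v.unitBall ∨ x⁻¹ ∈ v.unitBall :=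
  v.ball.mem_or_inv_mem x

theorem inv_mem_of_notMem (v : Locality K) {x : K} (hx : x ∉ v.unitBall) : x⁻¹ ∈ v.unitBall :=
  (v.mem_or_inv_mem x).resolve_left hx

theorem zero_mem (v : Locality K) : (0 : K) ∈ v.unitBall := by
  simpa using v.mem_or_inv_mem 0

theorem neg_one_mem (v : Locality K) : (-1 : K) ∈ v.unitBall := by
  have h := v.mem_or_inv_mem (-1)
  rwa [inv_neg, inv_one, or_self] at h

theorem neg_mem (v : Locality K) {x : K} (hx : x ∈ v.unitBall) : -x ∈ v.unitBall := by
  simpa using v.mul_mem v.neg_one_mem hx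

theorem mem_units_iff (v : Locality K) {x : K} :
    x ∈ v.units ↔ x ≠ 0 ∧ x ∈ v.unitBall ∧ x⁻¹ ∈ v.unitBall := by
  constructor
  · rintro ⟨h, y, hy, hy0, rfl⟩
    rw [inv_inv]
    exact ⟨inv_ne_zero hy0, h, hy⟩
  · rintro ⟨h0, h, h'⟩
    exact ⟨h, x⁻¹, h', inv_ne_zero h0, inv_inv x⟩

theorem mem_maximal_iff (v : Locality K) {x : K} :
    x ∈ v.maximal ↔ x = 0 ∨ x⁻¹ ∉ v.unitBall := by
  have key : x ∈ v.maximal ↔ x ∈ v.unitBall ∧ x ∉ v.units := Iff.rfl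
  rw [key, mem_units_iff]
  constructor
  · rintro ⟨h, h'⟩
    by_contra! hc
    exact h' ⟨hc.1, h, hc.2⟩
  · rintro (rfl | h)
    · exact ⟨v.zero_mem, fun h => h.1 rfl⟩
    · exact ⟨(v.mem_or_inv_mem x).resolve_right h, fun h' => h h'.2.2⟩

theorem mul_mem_maximal (v : Locality K) {x y : K} (hx : x ∈ v.unitBall) (hy : y ∈ v.maximal) :
    x * y ∈ v.maximal := by
  rw [mem_maximal_iff] at hy ⊢
  rcases hy with rfl | hy
  · simp
  · by_cases hx0 : x = 0
    · simp [hx0]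
    · refine Or.inr fun h => hy ?_
      have := v.mul_mem hx h
      rwa [mul_inv, ← mul_assoc, mul_inv_cancel₀ hx0, one_mul] at this

theorem inv_mem_maximal_of_notMem (v : Locality K) {x : K} (hx : x ∉ v.unitBall) :
    x⁻¹ ∈ v.maximal :=
  v.mem_maximal_iff.2 (Or.inr (by simpa using hx))

/-! ### Products of two unit balls as valuation rings. -/

/-- The product of the unit balls of two localities is a valuation ring as soon as it contains
`1 + x` for all `x` in the first ball. -/
theorem exists_valuationSubring_eq_mul (v w : Locality K)
    (h : ∀ x ∈ v.unitBall, 1 + x ∈ v.unitBall * w.unitBall) :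
    ∃ A : ValuationSubring K, (A : Set K) = v.unitBall * w.unitBall := by
  obtain ⟨P, hP⟩ : ∃ P, P = v.unitBall * w.unitBall := ⟨_, rfl⟩
  rw [← hP] at h
  have hv : v.unitBall ⊆ P := fun x hx => hP ▸ ⟨x, hx, 1, w.one_mem, mul_one x⟩
  have hmul : ∀ {x y}, x ∈ P → y ∈ P → x * y ∈ P := by
    rw [hP]
    rintro _ _ ⟨a, ha, b, hb, rfl⟩ ⟨c, hc, d, hd, rfl⟩
    exact ⟨a * c, v.mul_mem ha hc, b * d, w.mul_mem hb hd, by simp only; ring⟩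
  have hone : ∀ x ∈ P, 1 + x ∈ P := by
    intro x hx
    by_cases hxv : x ∈ v.unitBall
    · exact h x hxv
    · have hx0 : x ≠ 0 := by rintro rfl; exact hxv v.zero_mem
      -- Here `1 + x = x * (1 + x⁻¹)`, and `x⁻¹` lies in the first ball.
      have := hmul hx (h _ (v.inv_mem_of_notMem hxv))
      rwa [mul_add, mul_one, mul_inv_cancel₀ hx0, add_comm] at this
  have hdiv : ∀ {x y}, x ∈ P → x ≠ 0 → y / x ∈ P → x + y ∈ P := by
    intro x y hx hx0 hxy
    have := hmul hx (hone _ hxy)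
    rwa [mul_add, mul_one, mul_div_cancel₀ _ hx0] at this
  refine ⟨{ carrier := P
            mul_mem' := hmul
            one_mem' := hv v.one_mem
            add_mem' := fun {x y} hx hy => ?_
            zero_mem' := hv v.zero_mem
            neg_mem' := fun {x} hx => by simpa using hmul (hv v.neg_one_mem) hx
            mem_or_inv_mem' := fun x => (v.mem_or_inv_mem x).imp (@hv _) (@hv _) }, hP⟩
  by_cases hx0 : x = 0
  · simpa [hx0] using hy
  by_cases hy0 : y = 0
  · simpa [hy0] using hx
  rcases v.mem_or_inv_mem (y / x) with h' | h'
  · exact hdiv hx hx0 (hv h')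
  · rw [inv_div] at h'
    rw [add_comm]
    exact hdiv hy hy0 (hv h')

theorem IsOrd.half_one_add_mem {v : Locality K} (h : v.ball.IsOrd) {x : K}
    (hx : x ∈ v.unitBall) : (1 + x) / 2 ∈ v.unitBall := by
  obtain ⟨_, _, hv⟩ := h
  have hr : v.unitBall = Set.Icc (-1) 1 := by rw [unitBall, hv]; rfl
  rw [hr] at hx ⊢
  constructor <;> linarith [hx.1, hx.2]

theorem IsOrd.two_ne_zero {v : Locality K} (h : v.ball.IsOrd) : (2 : K) ≠ 0 := by
  obtain ⟨_, _, -⟩ := h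
  exact _root_.two_ne_zero

/-- An element of an ordered field all of whose powers are at most `2` in absolute value is
infinitesimally close to the interval `[-1, 1]`. -/
theorem IsOrd.exists_infinitesimal_sub {v : Locality K} (h : v.ball.IsOrd) {y : K}
    (hy : ∀ n : ℕ, y ^ n / 2 ∈ v.unitBall) :
    ∃ z ∈ v.unitBall, ∀ n : ℕ, n * (y - z) ∈ v.unitBall := by
  obtain ⟨_, _, hv⟩ := h
  have hr : v.unitBall = {x | |x| ≤ 1} := by
    ext x
    rw [unitBall, hv, Set.mem_ofPred_eq, abs_le]; rfl
  rw [hr] at hy ⊢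
  have hpow : ∀ n : ℕ, |y| ^ n ≤ 2 := by
    intro n
    have := hy n
    rwa [Set.mem_ofPred_eq, abs_div, abs_two, abs_pow, div_le_one two_pos] at this
  by_cases h1 : |y| ≤ 1
  · exact ⟨y, h1, fun n => by simp⟩
  push Not at h1
  -- Bernoulli: `1 + n * (|y| - 1) ≤ |y| ^ n ≤ 2`.
  have hb : ∀ n : ℕ, (n : K) * (|y| - 1) ≤ 1 := by
    intro n
    have h2 := one_add_mul_le_pow (show -2 ≤ |y| - 1 by linarith) n
    rw [add_sub_cancel] at h2
    linarith [hpow n]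
  have hn : ∀ n : ℕ, 0 ≤ (n : K) * (|y| - 1) := fun n =>
    mul_nonneg n.cast_nonneg (by linarith)
  rcases abs_choice y with hs | hs
  · refine ⟨1, by simp, fun n => ?_⟩
    rw [Set.mem_ofPred_eq, ← hs, abs_of_nonneg (hn n)]
    exact hb n
  · refine ⟨-1, by simp, fun n => ?_⟩
    have : (n : K) * (y - -1) = -(n * (|y| - 1)) := by rw [hs]; ring
    rw [Set.mem_ofPred_eq, this, abs_neg, abs_of_nonneg (hn n)]
    exact hb n

/-- The ring of finite elements of an ordered field. -/
theorem IsOrd.exists_finite_elements {v : Locality K} (h : v.ball.IsOrd) :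
    ∃ V : ValuationSubring K, v ≤ ofValuation V ∧ (∀ y, y / 2 ∈ v.unitBall → y ∈ V) ∧
      ∀ e : K, e ≠ 0 → (∀ n : ℕ, n * e ∈ v.unitBall) → e⁻¹ ∉ V := by
  obtain ⟨_, _, hv⟩ := h
  have hr : v.unitBall = {x | |x| ≤ 1} := by
    ext x
    rw [unitBall, hv, Set.mem_ofPred_eq, abs_le]; rfl
  change ∃ V : ValuationSubring K, v.unitBall ⊆ (V : Set K) ∧ _
  rw [hr]
  refine ⟨{ carrier := {x | ∃ n : ℕ, |x| ≤ n}
            mul_mem' := ?_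
            one_mem' := ⟨1, by simp⟩
            add_mem' := ?_
            zero_mem' := ⟨0, by simp⟩
            neg_mem' := ?_
            mem_or_inv_mem' := ?_ }, fun x hx => ⟨1, by simpa using hx⟩, ?_, ?_⟩
  · rintro x y ⟨n, hn⟩ ⟨m, hm⟩
    refine ⟨n * m, ?_⟩
    rw [abs_mul, Nat.cast_mul]
    exact mul_le_mul hn hm (abs_nonneg y) n.cast_nonneg
  · rintro x y ⟨n, hn⟩ ⟨m, hm⟩
    refine ⟨n + m, (abs_add_le x y).trans ?_⟩
    rw [Nat.cast_add]
    exact add_le_add hn hm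
  · rintro x ⟨n, hn⟩
    exact ⟨n, by simpa using hn⟩
  · intro x
    rcases le_total |x| 1 with h | h
    · exact Or.inl ⟨1, by simpa using h⟩
    · refine Or.inr ⟨1, ?_⟩
      rw [abs_inv, Nat.cast_one]
      exact inv_le_one_of_one_le₀ h
  · intro y hy
    rw [Set.mem_ofPred_eq, abs_div, abs_two, div_le_one two_pos] at hy
    exact ⟨2, by simpa using hy⟩
  · rintro e he hn ⟨N, hN⟩
    -- The factor `2` makes the contradiction strict: `|e⁻¹| ≤ N` gives `2 * N * |e| ≥ 2`.
    have h1 := hn (2 * N)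
    rw [Set.mem_ofPred_eq, abs_mul, Nat.abs_cast, Nat.cast_mul, Nat.cast_two] at h1
    rw [abs_inv, inv_le_iff_one_le_mul₀ (abs_pos.2 he)] at hN
    linarith

/-- Since `(1 + x) / 2` stays in the interval, only `2` has to be factored. If that fails, each of
the two intervals lies in twice the other, and the orderings agree on the residue field of the join
up to infinitesimals, against strong incomparability. -/
theorem one_add_mem_mul_of_isOrd {v w : Locality K} (hv : v.ball.IsOrd) (hw : w.ball.IsOrd)
    (h : StronglyIncomparable v w) : ∀ x ∈ v.unitBall, 1 + x ∈ v.unitBall * w.unitBall := by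
  have h2 : (2 : K) ≠ 0 := IsOrd.two_ne_zero hv
  by_cases htwo : (2 : K) ∈ v.unitBall * w.unitBall
  · intro x hx
    obtain ⟨a, ha, b, hb, hab⟩ := htwo
    refine ⟨(1 + x) / 2 * a, v.mul_mem (IsOrd.half_one_add_mem hv hx) ha, b, hb, ?_⟩
    have hab' : a * b = 2 := hab
    simp only
    rw [mul_assoc, hab', div_mul_cancel₀ _ h2]
  exfalso
  obtain ⟨-, A, hA, hne⟩ := h
  have sub : ∀ v w : Locality K, w.ball.IsOrd → (2 : K) ∉ v.unitBall * w.unitBall →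
      (∀ V : ValuationSubring K, v ≤ ofValuation V → w ≤ ofValuation V →
        ofValuation A ≤ ofValuation V) →
      ∀ (hvA : v.unitBall ⊆ (A : Set K)) (hwA : w.unitBall ⊆ (A : Set K)),
        (v.ball.induced A hvA).carrier ⊆ (w.ball.induced A hwA).carrier := by
    rintro v w hw htwo hmin hvA hwA _ ⟨a, ha, rfl⟩
    have hhalf : ∀ b ∈ v.unitBall, b / 2 ∈ w.unitBall := by
      intro b hb
      rcases w.mem_or_inv_mem (b / 2) with h | h
      · exact h
      · by_cases hb0 : b = 0
        · subst hb0
          simpa using w.zero_mem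
        · rw [inv_div] at h
          exact absurd ⟨b, hb, 2 / b, h, mul_div_cancel₀ _ hb0⟩ htwo
    -- All powers of `a` lie in `𝒪_v`, hence are at most `2` in absolute value for `w`. The ring `V`
    -- of `w`-finite elements contains both balls, hence also `A`, so the infinitesimal `a - z`
    -- vanishes in the residue field of `A`.
    obtain ⟨z, hz, hzn⟩ := IsOrd.exists_infinitesimal_sub hw
      (y := (a : K)) (fun n => hhalf _ (v.pow_mem ha n))
    obtain ⟨V, hwV, hV, hVinf⟩ := IsOrd.exists_finite_elements hw
    have hAV := hmin V (fun b hb => hV b (hhalf b hb)) hwV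
    refine ⟨⟨z, hwA hz⟩, hz, ?_⟩
    rw [eq_comm, ← sub_eq_zero, ← map_sub, IsLocalRing.residue_eq_zero_iff,
      ← ValuationSubring.coe_mem_nonunits_iff, ValuationSubring.mem_nonunits_iff_or]
    change (a : K) - z = 0 ∨ ((a : K) - z)⁻¹ ∉ A
    by_contra! hc
    exact hVinf _ hc.1 hzn (hAV hc.2)
  have hmin : ∀ V : ValuationSubring K, v ≤ ofValuation V → w ≤ ofValuation V →
      ofValuation A ≤ ofValuation V := by
    intro V h1 h2
    rw [← hA]
    refine (isLUB_join v w).2 ?_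
    rintro u (rfl | rfl) <;> assumption
  refine hne (BallSet.ext (subset_antisymm (sub v w hw htwo hmin _ _)
    (sub w v hv (by rwa [mul_comm]) (fun V h1 h2 => hmin V h2 h1) _ _)))

theorem IsVal.one_add_mem {v : Locality K} (h : v.ball.IsVal) {x : K} (hx : x ∈ v.unitBall) :
    1 + x ∈ v.unitBall := by
  obtain ⟨A, hA⟩ := h
  have hr : v.unitBall = (A : Set K) := by rw [unitBall, hA]; rfl
  rw [hr] at hx ⊢
  exact A.add_mem _ _ A.one_mem hx

/-- An absolute value is archimedean in rank: any `y ∈ 𝒪_w` with `|y|_v > 1` has a power absorbing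
`1 + x`. Such a `y` is missing only when `w ≤ v`. -/
theorem one_add_mem_mul_of_isAbs {v w : Locality K} (hv : v.ball.IsAbs)
    (h : w ≤ v → ∀ x ∈ v.unitBall, 1 + x ∈ v.unitBall) :
    ∀ x ∈ v.unitBall, 1 + x ∈ v.unitBall * w.unitBall := by
  intro x hx
  by_cases hwv : w ≤ v
  · exact ⟨1 + x, h hwv x hx, 1, w.one_mem, mul_one _⟩
  obtain ⟨y, hyw, hyv⟩ := Set.not_subset.1 hwv
  obtain ⟨a, ha⟩ := hv
  have hr : v.unitBall = {x | a x ≤ 1} := by rw [unitBall, ha]; rfl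
  have hy1 : 1 < a y := by
    rw [hr] at hyv
    exact not_le.1 hyv
  obtain ⟨n, hn⟩ := pow_unbounded_of_one_lt (a (1 + x)) hy1
  have hy0 : y ≠ 0 := by
    rintro rfl
    rw [map_zero] at hy1
    linarith
  refine ⟨(1 + x) / y ^ n, ?_, y ^ n, w.pow_mem hyw n, div_mul_cancel₀ _ (pow_ne_zero n hy0)⟩
  rw [hr, Set.mem_ofPred_eq, map_div₀, map_pow, div_le_one (by positivity)]
  exact hn.le

/-- The unit balls of two `t`-independent localities generate a valuation ring, every element of
which is a product of elements of the two balls. -/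
theorem TIndependent.exists_valuationSubring {t : K} {v w : Locality K}
    (h : TIndependent t v w) (hv : v.unitBall + v.unitBall ⊆ t⁻¹ • v.unitBall)
    (hw : w.unitBall + w.unitBall ⊆ t⁻¹ • w.unitBall) :
    ∃ A : ValuationSubring K, t⁻¹ ∈ A ∧ (A : Set K) = v.unitBall * w.unitBall := by
  have key : ∃ A : ValuationSubring K, (A : Set K) = v.unitBall * w.unitBall := by
    have habs : ∀ v w : Locality K, v.ball.IsAbs → t ∈ (join v w).units →
        v.unitBall + v.unitBall ⊆ t⁻¹ • v.unitBall →
          ∃ A : ValuationSubring K, (A : Set K) = v.unitBall * w.unitBall := by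
      intro v w hva ht hv
      -- If `w ≤ v`, the join is `v` itself, so `t` is a unit of `𝒪_v` and the factor `t⁻¹` in
      -- condition (iv) is harmless.
      refine exists_valuationSubring_eq_mul v w (one_add_mem_mul_of_isAbs hva fun hle x hx => ?_)
      have hj : join v w = v := by
        refine le_antisymm ((isLUB_join v w).2 ?_) (le_join_left v w)
        rintro u (rfl | rfl)
        exacts [le_rfl, hle]
      rw [hj, mem_units_iff] at ht
      obtain ⟨y, hy, hyx⟩ := hv (Set.add_mem_add v.one_mem hx)
      rw [← hyx]
      exact v.mul_mem ht.2.2 hy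
    have hval : ∀ v w : Locality K, v.ball.IsVal →
        ∃ A : ValuationSubring K, (A : Set K) = v.unitBall * w.unitBall := fun v w hv =>
      exists_valuationSubring_eq_mul v w fun x hx =>
        ⟨1 + x, IsVal.one_add_mem hv hx, 1, w.one_mem, mul_one _⟩
    have hcomm : join w v = join v w :=
      (isLUB_join w v).unique (by rw [Set.pair_comm]; exact isLUB_join v w)
    rcases v.isLocality with h1 | h1 | h1
    · exact hval v w h1
    · rcases w.isLocality with h2 | h2 | h2
      · rw [mul_comm]
        exact hval w v h2
      · exact exists_valuationSubring_eq_mul v w (one_add_mem_mul_of_isOrd h1 h2 (h.2 h1 h2))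
      · rw [mul_comm]
        exact habs w v h2 (hcomm ▸ h.1) hw
    · exact habs v w h1 h.1 hv
  obtain ⟨A, hA⟩ := key
  refine ⟨A, ?_, hA⟩
  have hle : join v w ≤ ofValuation A := by
    refine (isLUB_join v w).2 ?_
    rintro u (rfl | rfl)
    · exact fun x hx => hA.ge ⟨x, hx, 1, w.one_mem, mul_one x⟩
    · exact fun x hx => hA.ge ⟨1, v.one_mem, x, hx, one_mul x⟩
  exact hle ((mem_units_iff _).1 h.1).2.2

end Locality

/-! ### Size estimates from the uniformity polynomial. -/

namespace Locality

variable {K : Type*} [Field K]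

/-- The conclusions of the uniformity condition for `f`, expressed as membership in unit balls. -/
structure IsUniform (f : K[X]) (t : K) (Q : Set (Locality K)) : Prop where
  two_le_natDegree : 2 ≤ f.natDegree
  ne_zero : t ≠ 0
  eval_of_mem : ∀ v ∈ Q, ∀ x ∈ v.unitBall,
    f.eval x ≠ 0 ∧ f.eval x ∈ v.unitBall ∧ t * (f.eval x)⁻¹ ∈ v.unitBall
  eval_of_notMem : ∀ v ∈ Q, ∀ x ∉ v.unitBall, f.eval x ≠ 0 ∧
    f.eval x * (x ^ f.natDegree)⁻¹ ∈ v.unitBall ∧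
    t * x ^ f.natDegree * (f.eval x)⁻¹ ∈ v.unitBall ∧
    (f.eval x - f.leadingCoeff * x ^ f.natDegree) * (x ^ (f.natDegree - 1))⁻¹ ∈ v.unitBall
  add_mem : ∀ v ∈ Q, ∀ x ∈ v.unitBall, ∀ y ∈ v.unitBall, t * (x + y) ∈ v.unitBall

theorem ne_zero_and_mul_inv_mem_of_notMem_smul {v : Locality K} {t x : K} (ht : t ≠ 0)
    (h : x ∉ t • v.maximal) : x ≠ 0 ∧ t * x⁻¹ ∈ v.unitBall := by
  rw [Set.mem_smul_set_iff_inv_smul_mem₀ ht, mem_maximal_iff, not_or, not_not, smul_eq_mul,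
    mul_inv, inv_inv] at h
  exact ⟨fun h0 => h.1 (by simp [h0]), h.2⟩

theorem Uniformity.exists_isUniform {Q : Set (Locality K)} {t : K} (ht : t ≠ 0)
    (h : Uniformity Q t) : ∃ f : K[X], IsUniform f t Q := by
  obtain ⟨f, hd, hf⟩ := h
  refine ⟨f, hd, ht, fun v hv x hx => ?_, fun v hv x hx => ?_, fun v hv x hx y hy => ?_⟩
  · obtain ⟨h1, h2, -, -⟩ := hf v hv
    have h3 := ne_zero_and_mul_inv_mem_of_notMem_smul ht (h2 x hx)
    exact ⟨h3.1, h1 x hx, h3.2⟩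
  · obtain ⟨-, -, h3, -⟩ := hf v hv
    obtain ⟨⟨a, ⟨ha, hat⟩, hax⟩, b, hb, c, ⟨e, he, rfl⟩, hbc⟩ := h3 x hx
    have hx0 : x ≠ 0 := by rintro rfl; exact hx v.zero_mem
    have h4 := ne_zero_and_mul_inv_mem_of_notMem_smul ht hat
    rw [Set.mem_singleton_iff] at hb
    subst hb
    simp only [smul_eq_mul] at hax hbc
    refine ⟨?_, ?_, ?_, ?_⟩
    · rw [← hax]
      exact mul_ne_zero (pow_ne_zero _ hx0) h4.1
    · rw [← hax]
      convert ha using 1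
      field_simp
    · rw [← hax]
      convert h4.2 using 1
      have := h4.1
      field_simp
    · rw [← hbc]
      convert he using 1
      field_simp
      ring
  · obtain ⟨z, hz, hzx⟩ := (hf v hv).2.2.2 (Set.add_mem_add hx hy)
    simp only [smul_eq_mul] at hzx
    rwa [← hzx, mul_inv_cancel_left₀ ht]

section Uniform

variable {f : K[X]} {t : K} {Q : Set (Locality K)}

theorem IsUniform.mem (hf : IsUniform f t Q) {v : Locality K} (hv : v ∈ Q) : t ∈ v.unitBall := by
  simpa using hf.add_mem v hv 1 v.one_mem 0 v.zero_mem

theorem IsUniform.sub_mem (hf : IsUniform f t Q) {v : Locality K} (hv : v ∈ Q) {x y : K}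
    (hx : x ∈ v.unitBall) (hy : y ∈ v.unitBall) : t * (x - y) ∈ v.unitBall := by
  rw [sub_eq_add_neg]
  exact hf.add_mem v hv x hx _ (v.neg_mem hy)

theorem IsUniform.eval_ne_zero (hf : IsUniform f t Q) {v : Locality K} (hv : v ∈ Q) (x : K) :
    f.eval x ≠ 0 := by
  by_cases hx : x ∈ v.unitBall
  · exact (hf.eval_of_mem v hv x hx).1
  · exact (hf.eval_of_notMem v hv x hx).1

/-- There is an element that is large at all `v ∈ Q`, at least as large as `x`, and belongs to
all valuation rings that contain `x` and `t⁻¹`. -/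
theorem IsUniform.exists_dominating (hf : IsUniform f t Q) (hQ : Q.Nonempty) (x : K) :
    ∃ c : K, c ≠ 0 ∧ ∀ v ∈ Q, c⁻¹ ∈ v.unitBall ∧ x * c⁻¹ ∈ v.unitBall ∧
      ∀ A : ValuationSubring K, v.unitBall ⊆ A → t⁻¹ ∈ A → x ∈ A → c ∈ A := by
  obtain ⟨v₀, hv₀⟩ := hQ
  have ht := hf.ne_zero
  refine ⟨f.eval x * t⁻¹, mul_ne_zero (hf.eval_ne_zero hv₀ x) (inv_ne_zero ht), fun v hv => ?_⟩
  rw [mul_inv, inv_inv, mul_comm _ t]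
  by_cases hx : x ∈ v.unitBall
  · obtain ⟨-, h1, h2⟩ := hf.eval_of_mem v hv x hx
    exact ⟨h2, v.mul_mem hx h2, fun A hA htA _ => A.mul_mem _ _ (hA h1) htA⟩
  · obtain ⟨-, h1, h2, -⟩ := hf.eval_of_notMem v hv x hx
    have hx0 : x ≠ 0 := by rintro rfl; exact hx v.zero_mem
    have hxi := v.inv_mem_of_notMem hx
    have h3 : x * (t * (f.eval x)⁻¹) ∈ v.unitBall := by
      convert v.mul_mem h2 (v.pow_mem hxi (f.natDegree - 1)) using 1
      obtain ⟨k, hk⟩ := Nat.exists_eq_add_of_le' hf.two_le_natDegree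
      rw [hk, Nat.add_sub_cancel_right (n := k + 1) (m := 1), inv_pow]
      field_simp
      ring
    refine ⟨?_, h3, fun A hA htA hxA => A.mul_mem _ _ ?_ htA⟩
    · convert v.mul_mem hxi h3 using 1
      field_simp
    · convert A.mul_mem _ _ (hA h1) (_root_.pow_mem hxA f.natDegree) using 1
      field_simp

/-- At any `x` outside the ball, `a_d` is the difference of `f(x) / x ^ d` and a ball element times
`x⁻¹`. If no such `x` exists, the ball is all of `K`. -/
theorem IsUniform.leadingCoeff_mem (hf : IsUniform f t Q) {v : Locality K} (hv : v ∈ Q) :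
    t * f.leadingCoeff ∈ v.unitBall := by
  by_cases h : ∃ x, x ∉ v.unitBall
  · obtain ⟨x, hx⟩ := h
    obtain ⟨-, h1, -, h3⟩ := hf.eval_of_notMem v hv x hx
    have hx0 : x ≠ 0 := by rintro rfl; exact hx v.zero_mem
    convert hf.sub_mem hv h1 (v.mul_mem h3 (v.inv_mem_of_notMem hx)) using 1
    obtain ⟨k, hk⟩ := Nat.exists_eq_add_of_le' hf.two_le_natDegree
    rw [hk, Nat.add_sub_cancel_right (n := k + 1) (m := 1)]
    field_simp
    ring
  · push Not at h
    exact h _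

/-- An element close to `1` where `e` is large and close to `0` where `e` is small. -/
theorem IsUniform.exists_cutoff (hf : IsUniform f t Q) {e : K} (he : e ≠ 0) :
    ∃ g : K, ∀ v ∈ Q, (e⁻¹ ∈ v.unitBall → (g - 1) * t ^ 3 * e ∈ v.unitBall) ∧
      (e ∈ v.unitBall → g * t ^ 2 * e⁻¹ ∈ v.unitBall) := by
  refine ⟨f.leadingCoeff * e ^ f.natDegree * (f.eval e)⁻¹, fun v hv => ?_⟩
  have h0 := hf.eval_ne_zero hv e
  have ha := hf.leadingCoeff_mem hv
  have htv := hf.mem hv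
  obtain ⟨k, hk⟩ := Nat.exists_eq_add_of_le' hf.two_le_natDegree
  constructor
  · intro hei
    by_cases hev : e ∈ v.unitBall
    -- Here `e` is a unit, so no asymptotics are needed: the crude bounds on `a_d * e ^ d` and
    -- `f(e)` suffice.
    · obtain ⟨-, h1, h2⟩ := hf.eval_of_mem v hv e hev
      convert v.mul_mem (v.mul_mem hev h2) (hf.sub_mem hv
        (v.mul_mem ha (v.pow_mem hev f.natDegree)) (v.mul_mem htv h1)) using 1
      field_simp
    · obtain ⟨-, h1, h2, h3⟩ := hf.eval_of_notMem v hv e hev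
      convert v.neg_mem (v.mul_mem (v.pow_mem htv 2) (v.mul_mem h2 h3)) using 1
      rw [hk, Nat.add_sub_cancel_right (n := k + 1) (m := 1)]
      field_simp
      ring
  · intro hev
    obtain ⟨-, h1, h2⟩ := hf.eval_of_mem v hv e hev
    convert v.mul_mem (v.mul_mem ha h2) (v.pow_mem hev (f.natDegree - 1)) using 1
    rw [hk, Nat.add_sub_cancel_right (n := k + 1) (m := 1)]
    field_simp
    ring

/-! ### Ball systems and approximate maxima. -/

/-- A choice of a family of neighbourhoods of zero, namely of the closed or the open unit balls,
by the properties they share. -/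
structure IsBallSystem (t : K) (Q : Set (Locality K)) (B : Locality K → Set K) : Prop where
  subset : ∀ v, B v ⊆ v.unitBall
  mul_mem : ∀ v, ∀ x ∈ v.unitBall, ∀ y ∈ B v, x * y ∈ B v
  zero_mem : ∀ v, 0 ∈ B v
  add_mem : ∀ v ∈ Q, ∀ x ∈ B v, ∀ y ∈ B v, t * (x + y) ∈ B v

theorem IsUniform.isBallSystem_unitBall (hf : IsUniform f t Q) :
    IsBallSystem t Q unitBall where
  subset _ := subset_rfl
  mul_mem v _ hx _ hy := v.mul_mem hx hy
  zero_mem := zero_mem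
  add_mem := hf.add_mem

/-- For addition, factor out the larger summand: `t * (x + y) = t * (1 + y / x) * x`, with `t * (1 +
y / x)` in the ball. -/
theorem IsUniform.isBallSystem_maximal (hf : IsUniform f t Q) :
    IsBallSystem t Q maximal where
  subset _ _ hx := hx.1
  mul_mem v _ hx _ hy := v.mul_mem_maximal hx hy
  zero_mem v := v.mem_maximal_iff.2 (Or.inl rfl)
  add_mem v hv := by
    have key : ∀ x y : K, x ≠ 0 → x ∈ v.maximal → y / x ∈ v.unitBall →
        t * (x + y) ∈ v.maximal := by
      intro x y hx0 hx hyx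
      convert v.mul_mem_maximal (hf.add_mem v hv 1 v.one_mem _ hyx) hx using 1
      field_simp
    intro x hx y hy
    by_cases hx0 : x = 0
    · rw [hx0, zero_add]
      exact v.mul_mem_maximal (hf.mem hv) hy
    by_cases hy0 : y = 0
    · rw [hy0, add_zero]
      exact v.mul_mem_maximal (hf.mem hv) hx
    rcases v.mem_or_inv_mem (y / x) with h | h
    · exact key x y hx0 hx h
    · rw [inv_div] at h
      rw [add_comm]
      exact key y x hy0 hy h

variable {B : Locality K → Set K}

/-- An approximate maximum of two elements. -/
theorem IsUniform.exists_max (hf : IsUniform f t Q) (hB : IsBallSystem t Q B) (hQ : Q.Nonempty)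
    {x y : K} (hx : x ≠ 0) (hy : y ≠ 0) :
    ∃ m : K, m ≠ 0 ∧ ∀ v ∈ Q, (x ∈ B v → y ∈ B v → m ∈ B v) ∧
      ((t * x)⁻¹ ∈ v.unitBall → x * m⁻¹ ∈ v.unitBall) ∧
      ((t * y)⁻¹ ∈ v.unitBall → y * m⁻¹ ∈ v.unitBall) := by
  obtain ⟨v₀, hv₀⟩ := hQ
  have ht := hf.ne_zero
  obtain ⟨k, hk⟩ := Nat.exists_eq_add_of_le' hf.two_le_natDegree
  refine ⟨y ^ f.natDegree * f.eval (x / y),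
    mul_ne_zero (pow_ne_zero _ hy) (hf.eval_ne_zero hv₀ _), fun v hv => ?_⟩
  -- In both cases below `m = r ^ d * h`, where `r` is the larger of `x`, `y` and both `h` and `t /
  -- h` lie in the ball.
  have key : ∀ r h : K, r ≠ 0 → h ≠ 0 → h ∈ v.unitBall → t * h⁻¹ ∈ v.unitBall →
      (r ∈ B v → r ^ f.natDegree * h ∈ B v) ∧
      ((t * r)⁻¹ ∈ v.unitBall → r * (r ^ f.natDegree * h)⁻¹ ∈ v.unitBall) := by
    intro r h hr hh0 hh hth
    constructor
    · intro hrB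
      rw [hk, mul_comm, pow_succ, ← mul_assoc]
      exact hB.mul_mem v _ (v.mul_mem hh (v.pow_mem (hB.subset v hrB) _)) _ hrB
    · intro hri
      -- The bound `d ≥ 2` is needed here: `r / r ^ d` retains a factor `r⁻¹`, and `(t * r)⁻¹`
      -- cancels the `t` of `t / h`.
      convert v.mul_mem (v.mul_mem hth hri)
        (v.pow_mem (v.mul_mem (hf.mem hv) hri) k) using 1
      rw [hk, mul_pow, inv_pow, mul_pow]
      field_simp
      ring
  have hxy : ∀ a b : K, a ≠ 0 → a / b ∈ v.unitBall → (t * a)⁻¹ ∈ v.unitBall →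
      (t * b)⁻¹ ∈ v.unitBall := by
    intro a b ha hab hat
    convert v.mul_mem hab hat using 1
    field_simp
  by_cases h : x / y ∈ v.unitBall
  · obtain ⟨h1, h2, h3⟩ := hf.eval_of_mem v hv _ h
    obtain ⟨k1, k2⟩ := key y _ hy h1 h2 h3
    refine ⟨fun _ => k1, fun hxt => ?_, k2⟩
    convert v.mul_mem h (k2 (hxy x y hx h hxt)) using 1
    field_simp
  · obtain ⟨h1, h2, h3, -⟩ := hf.eval_of_notMem v hv _ h
    have h' : y / x ∈ v.unitBall := by simpa using v.inv_mem_of_notMem h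
    obtain ⟨k1, k2⟩ := key x (f.eval (x / y) * ((x / y) ^ f.natDegree)⁻¹) hx
      (by positivity) h2 (by convert h3 using 1; field_simp)
    have he : y ^ f.natDegree * f.eval (x / y) =
        x ^ f.natDegree * (f.eval (x / y) * ((x / y) ^ f.natDegree)⁻¹) := by
      have hpow : x ^ f.natDegree = (x / y) ^ f.natDegree * y ^ f.natDegree := by
        rw [← mul_pow, div_mul_cancel₀ x hy]
      have hne : (x / y) ^ f.natDegree ≠ 0 := pow_ne_zero _ (div_ne_zero hx hy)
      rw [hpow, mul_assoc, mul_left_comm, mul_left_comm _ (f.eval (x / y)), mul_inv_cancel₀ hne,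
        mul_one]
    rw [he]
    refine ⟨fun hx _ => k1 hx, k2, fun hyt => ?_⟩
    convert v.mul_mem h' (k2 (hxy y x hy h' hyt)) using 1
    field_simp

/-! ### Separation of compact sets. -/

/-- Passage from separation at each point of a compact set to uniform separation. -/
theorem IsUniform.exists_separating_of_forall [TopologicalSpace (Locality K)]
    (hf : IsUniform f t Q) (hB : IsBallSystem t Q B) (hopen : ∀ x : K, IsOpen {v | x ∈ B v})
    {S T : Set (Locality K)} (hS : IsCompact S) (hSne : S.Nonempty) (hSQ : S ⊆ Q) (hTQ : T ⊆ Q)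
    {c : K} (hc0 : c ≠ 0) (hc : ∀ v ∈ Q, (t * c)⁻¹ ∈ v.unitBall)
    (h : ∀ v ∈ S, ∃ a : K, a ≠ 0 ∧ (∀ w ∈ T, a ∈ B w) ∧ c * a⁻¹ ∈ B v) :
    ∃ a : K, a ≠ 0 ∧ (∀ w ∈ T, a ∈ B w) ∧ ∀ v ∈ S, c * a⁻¹ ∈ B v := by
  have main : ∃ a : K, a ≠ 0 ∧ (∀ w ∈ T, a ∈ B w) ∧ ∀ v ∈ S ∩ S, c * a⁻¹ ∈ B v := by
    refine hS.induction_on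
      (p := fun s => ∃ a : K, a ≠ 0 ∧ (∀ w ∈ T, a ∈ B w) ∧ ∀ v ∈ s ∩ S, c * a⁻¹ ∈ B v)
      ?_ ?_ ?_ ?_
    · obtain ⟨v, hv⟩ := hSne
      obtain ⟨a, ha, haT, -⟩ := h v hv
      exact ⟨a, ha, haT, by simp⟩
    · rintro s s' hss' ⟨a, ha, haT, has⟩
      exact ⟨a, ha, haT, fun v hv => has v ⟨hss' hv.1, hv.2⟩⟩
    · rintro s s' ⟨a, ha, haT, has⟩ ⟨b, hb, hbT, hbs⟩
      obtain ⟨m, hm, hmQ⟩ := hf.exists_max hB (hSne.mono hSQ) ha hb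
      have key : ∀ v ∈ Q, ∀ r : K, r ≠ 0 → ((t * r)⁻¹ ∈ v.unitBall → r * m⁻¹ ∈ v.unitBall) →
          c * r⁻¹ ∈ B v → c * m⁻¹ ∈ B v := by
        intro v hv r hr hrm hcr
        -- The largeness of `c` makes `r` large enough for the lower bound on the maximum.
        have h1 : (t * r)⁻¹ ∈ v.unitBall := by
          convert v.mul_mem (hc v hv) (hB.subset v hcr) using 1
          have := hf.ne_zero
          field_simp
        convert hB.mul_mem v _ (hrm h1) _ hcr using 1
        field_simp
      refine ⟨m, hm, fun w hw => (hmQ w (hTQ hw)).1 (haT w hw) (hbT w hw), ?_⟩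
      rintro v ⟨hv | hv, hvS⟩
      · exact key v (hSQ hvS) a ha (hmQ v (hSQ hvS)).2.1 (has v ⟨hv, hvS⟩)
      · exact key v (hSQ hvS) b hb (hmQ v (hSQ hvS)).2.2 (hbs v ⟨hv, hvS⟩)
    · intro v hv
      obtain ⟨a, ha, haT, hav⟩ := h v hv
      exact ⟨_, mem_nhdsWithin_of_mem_nhds ((hopen (c * a⁻¹)).mem_nhds hav), a, ha, haT,
        fun w hw => hw.1⟩
  simpa using main

/-- Compactness is used twice, over `T` for fixed `v` and then over `S`. The involution `a ↦ c / a`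
exchanges the two sets, so one lemma serves both passes. -/
theorem IsUniform.exists_separating [TopologicalSpace (Locality K)]
    (hf : IsUniform f t Q) (hB : IsBallSystem t Q B) (hopen : ∀ x : K, IsOpen {v | x ∈ B v})
    {S T : Set (Locality K)} (hS : IsCompact S) (hSne : S.Nonempty) (hSQ : S ⊆ Q)
    (hT : IsCompact T) (hTne : T.Nonempty) (hTQ : T ⊆ Q)
    {c : K} (hc0 : c ≠ 0) (hc : ∀ v ∈ Q, (t * c)⁻¹ ∈ v.unitBall)
    (h : ∀ v ∈ S, ∀ w ∈ T, ∃ a : K, a ≠ 0 ∧ a ∈ B w ∧ c * a⁻¹ ∈ B v) :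
    ∃ a : K, a ≠ 0 ∧ (∀ w ∈ T, a ∈ B w) ∧ ∀ v ∈ S, c * a⁻¹ ∈ B v := by
  refine hf.exists_separating_of_forall hB hopen hS hSne hSQ hTQ hc0 hc fun v hv => ?_
  have hinv : ∀ a : K, c * (c * a⁻¹)⁻¹ = a := fun a => by
    rw [mul_inv, inv_inv, mul_inv_cancel_left₀ hc0]
  obtain ⟨a, ha, hav, haT⟩ := hf.exists_separating_of_forall hB hopen (T := {v}) hT hTne hTQ
    (Set.singleton_subset_iff.2 (hSQ hv)) hc0 hc fun w hw => by
      obtain ⟨a, ha, haw, hav⟩ := h v hv w hw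
      refine ⟨c * a⁻¹, mul_ne_zero hc0 (inv_ne_zero ha), ?_, ?_⟩
      · rintro _ rfl
        exact hav
      · rwa [hinv]
  refine ⟨c * a⁻¹, mul_ne_zero hc0 (inv_ne_zero ha), haT, ?_⟩
  rw [hinv]
  exact hav v rfl

end Uniform

end Locality

/-! ### Simultaneous separation and the approximation induction. -/

namespace Locality

variable {K : Type*} [Field K] {f : K[X]} {t : K} {Q : Set (Locality K)} {B : Locality K → Set K}

/-- Elements of `A` split as products compatible with the balls `B v` and `B w`. -/
def Splits (B : Locality K → Set K) (v w : Locality K) (A : ValuationSubring K) : Prop :=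
  v.unitBall ⊆ A ∧ w.unitBall ⊆ A ∧ ∀ c ∈ A, c ≠ 0 → ∃ a : K, a ≠ 0 ∧ a ∈ B v ∧ c * a⁻¹ ∈ B w

theorem splits_unitBall {v w : Locality K} {A : ValuationSubring K}
    (hA : (A : Set K) = v.unitBall * w.unitBall) : Splits unitBall v w A := by
  refine ⟨fun a ha => hA.ge ⟨a, ha, 1, w.one_mem, mul_one a⟩,
    fun a ha => hA.ge ⟨1, v.one_mem, a, ha, one_mul a⟩, fun c hc hc0 => ?_⟩
  obtain ⟨a, ha, b, hb, rfl⟩ := hA.le hc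
  have ha0 : a ≠ 0 := left_ne_zero_of_mul hc0
  refine ⟨a, ha0, ha, ?_⟩
  simpa [mul_comm a b, mul_assoc, mul_inv_cancel₀ ha0] using hb

/-- With `p ∈ 𝒪_v \ 𝒪_w` and `q ∈ 𝒪_w \ 𝒪_v`, the factor `p / q` lies in `𝔪_v` and its inverse in
`𝔪_w`; shifting it between the two factors makes both strictly small. -/
theorem splits_maximal {v w : Locality K} {A : ValuationSubring K}
    (hA : (A : Set K) = v.unitBall * w.unitBall) (h : Incomparable v w) :
    Splits maximal v w A := by
  obtain ⟨hv, hw, hs⟩ := splits_unitBall hA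
  refine ⟨hv, hw, fun c hc hc0 => ?_⟩
  obtain ⟨a, ha0, ha, hca⟩ := hs c hc hc0
  obtain ⟨p, hpv, hpw⟩ := Set.not_subset.1 h.1
  obtain ⟨q, hqw, hqv⟩ := Set.not_subset.1 h.2
  have hp0 : p ≠ 0 := by rintro rfl; exact hpw w.zero_mem
  have hq0 : q ≠ 0 := by rintro rfl; exact hqv v.zero_mem
  refine ⟨a * p * q⁻¹, by positivity, v.mul_mem_maximal (v.mul_mem ha hpv)
    (v.inv_mem_maximal_of_notMem hqv), ?_⟩
  convert w.mul_mem_maximal (w.mul_mem hca hqw) (w.inv_mem_maximal_of_notMem hpw) using 1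
  field_simp

/-- A simultaneous choice of separating elements for finitely many compact sets `S i`. -/
theorem IsUniform.exists_large [TopologicalSpace (Locality K)] {ι : Type*}
    (hf : IsUniform f t Q) (hB : IsBallSystem t Q B) (hopen : ∀ x : K, IsOpen {v | x ∈ B v})
    (S : ι → Set (Locality K)) (hS : ∀ i, IsCompact (S i)) (hSQ : ∀ i, S i ⊆ Q)
    {T : Set (Locality K)} (hT : IsCompact T) (hTne : T.Nonempty) (hTQ : T ⊆ Q)
    (I : Finset ι) (hI : I.Nonempty) (hSne : ∀ i ∈ I, (S i).Nonempty) (D : ι → K) (s : K)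
    (hs0 : s ≠ 0) (hs : ∀ v ∈ Q, s⁻¹ ∈ v.unitBall) (hst : ∀ v ∈ Q, (t * s)⁻¹ ∈ v.unitBall)
    (h : ∀ i ∈ I, ∀ v ∈ S i, ∀ w ∈ T, ∃ A : ValuationSubring K,
      Splits B v w A ∧ t⁻¹ ∈ A ∧ s ∈ A ∧ D i ∈ A) :
    ∃ E : K, E ≠ 0 ∧ (∀ w ∈ T, s * E ∈ B w) ∧
      ∀ i ∈ I, ∀ v ∈ S i, E⁻¹ ∈ v.unitBall ∧ D i * E⁻¹ ∈ B v := by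
  have hQ : Q.Nonempty := hTne.mono hTQ
  have hsingle : ∀ i ∈ I, ∃ E : K, E ≠ 0 ∧ (∀ w ∈ T, s * E ∈ B w) ∧
      ∀ v ∈ S i, E⁻¹ ∈ v.unitBall ∧ s * E⁻¹ ∈ v.unitBall ∧ D i * E⁻¹ ∈ B v := by
    intro i hi
    obtain ⟨b, hb0, hb⟩ := hf.exists_dominating hQ (D i)
    obtain ⟨C, hC⟩ : ∃ C, C = s * b := ⟨_, rfl⟩
    have hC0 : C ≠ 0 := hC ▸ mul_ne_zero hs0 hb0
    have hsC : ∀ v ∈ Q, s * C⁻¹ ∈ v.unitBall := fun v hv => by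
      rw [hC, mul_inv, mul_inv_cancel_left₀ hs0]
      exact (hb v hv).1
    have hCinv : ∀ v ∈ Q, C⁻¹ ∈ v.unitBall := fun v hv => by
      rw [hC, mul_inv]
      exact v.mul_mem (hs v hv) (hb v hv).1
    have hDC : ∀ v ∈ Q, D i * C⁻¹ ∈ v.unitBall := fun v hv => by
      convert v.mul_mem (hs v hv) (hb v hv).2.1 using 1
      rw [hC, mul_inv]
      ring
    -- Separating the square of `C` lets `E = C / a` work on both sides: on `T`, `s * E = (s / C) *
    -- (C ^ 2 / a)`, and on `S i`, `D i / E = (D i / C) * a`.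
    obtain ⟨a, ha0, haS, haT⟩ := hf.exists_separating hB hopen (c := C * C) hT hTne hTQ
      (hS i) (hSne i hi) (hSQ i) (mul_ne_zero hC0 hC0)
      (fun v hv => by
        convert v.mul_mem (v.mul_mem (hst v hv) (hsC v hv)) (hCinv v hv) using 1
        have := hf.ne_zero
        field_simp)
      (fun w hw v hv => by
        obtain ⟨A, hA, htA, hsA, hDA⟩ := h i hi v hv w hw
        have hCA : C ∈ A :=
          hC ▸ A.mul_mem _ _ hsA ((hb v (hSQ i hv)).2.2 A hA.1 htA hDA)
        exact hA.2.2 _ (A.mul_mem _ _ hCA hCA) (mul_ne_zero hC0 hC0))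
    refine ⟨C * a⁻¹, mul_ne_zero hC0 (inv_ne_zero ha0), fun w hw => ?_, fun v hv => ?_⟩
    · convert hB.mul_mem w _ (hsC w (hTQ hw)) _ (haT w hw) using 1
      field_simp
    · have hvQ := hSQ i hv
      have key : ∀ r : K, r * C⁻¹ ∈ v.unitBall → r * (C * a⁻¹)⁻¹ ∈ B v := fun r hr => by
        convert hB.mul_mem v _ hr _ (haS v hv) using 1
        field_simp
      refine ⟨?_, hB.subset v (key _ (hsC v hvQ)), key _ (hDC v hvQ)⟩
      simpa using hB.subset v (key 1 (by simpa using hCinv v hvQ))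
  clear h
  induction hI using Finset.Nonempty.cons_induction with
  | singleton i =>
    obtain ⟨E, hE0, hET, hES⟩ := hsingle i (Finset.mem_singleton_self i)
    refine ⟨E, hE0, hET, fun j hj v hv => ?_⟩
    obtain rfl := Finset.mem_singleton.1 hj
    exact ⟨(hES v hv).1, (hES v hv).2.2⟩
  | cons i I hi hI ih =>
    obtain ⟨E, hE0, hET, hES⟩ := hsingle i (Finset.mem_cons_self i I)
    obtain ⟨F, hF0, hFT, hFS⟩ := ih (fun j hj => hSne j (Finset.mem_cons_of_mem hj))
      (fun j hj => hsingle j (Finset.mem_cons_of_mem hj))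
    -- The maximum is taken after scaling by `s`, since its lower bounds require `(t * s * r)⁻¹` in
    -- the ball; the scaling is undone in the witness `s⁻¹ * m`.
    obtain ⟨m, hm0, hm⟩ := hf.exists_max hB hQ (mul_ne_zero hs0 hE0) (mul_ne_zero hs0 hF0)
    have key : ∀ v ∈ Q, ∀ r : K, r ≠ 0 → ∀ d : K,
        ((t * (s * r))⁻¹ ∈ v.unitBall → s * r * m⁻¹ ∈ v.unitBall) →
        r⁻¹ ∈ v.unitBall ∧ d * r⁻¹ ∈ B v →
        (s⁻¹ * m)⁻¹ ∈ v.unitBall ∧ d * (s⁻¹ * m)⁻¹ ∈ B v := by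
      intro v hv r hr d hrm hd
      have h1 : s * r * m⁻¹ ∈ v.unitBall := hrm (by
        convert v.mul_mem (hst v hv) hd.1 using 1
        rw [← mul_assoc, mul_inv])
      constructor
      · convert v.mul_mem h1 hd.1 using 1
        field_simp
      · convert hB.mul_mem v _ h1 _ hd.2 using 1
        field_simp
    refine ⟨s⁻¹ * m, mul_ne_zero (inv_ne_zero hs0) hm0, fun w hw => ?_, fun j hj v hv => ?_⟩
    · rw [mul_inv_cancel_left₀ hs0]
      exact (hm w (hTQ hw)).1 (hET w hw) (hFT w hw)
    · have hvQ := hSQ j hv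
      rcases Finset.mem_cons.1 hj with rfl | hj
      · exact key v hvQ E hE0 _ (hm v hvQ).2.1 ⟨(hES v hv).1, (hES v hv).2.2⟩
      · exact key v hvQ F hF0 _ (hm v hvQ).2.2 (hFS j hj v hv)

theorem IsUniform.exists_approximation [TopologicalSpace (Locality K)] {ι : Type*}
    (hf : IsUniform f t Q) (hB : IsBallSystem t Q B) (hopen : ∀ x : K, IsOpen {v | x ∈ B v})
    (S : ι → Set (Locality K)) (hS : ∀ i, IsCompact (S i)) (hSQ : ∀ i, S i ⊆ Q) (x : ι → K)
    (I : Finset ι) (hSne : ∀ i ∈ I, (S i).Nonempty) (z : ι → K) (hz : ∀ i ∈ I, z i ≠ 0)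
    (h : ∀ i ∈ I, ∀ j ∈ I, i ≠ j → ∀ v ∈ S i, ∀ w ∈ S j, ∃ A : ValuationSubring K,
      Splits B v w A ∧ t⁻¹ ∈ A ∧ (x i - x j) * (z i)⁻¹ ∈ A ∧ z i * (z j)⁻¹ ∈ A) :
    ∃ a : K, ∀ i ∈ I, ∀ v ∈ S i, (a - x i) * (z i)⁻¹ ∈ B v := by
  classical
  have ht := hf.ne_zero
  induction I using Finset.induction_on generalizing z with
  | empty => exact ⟨0, by simp⟩
  | insert j I hj ih =>
    have hjI := Finset.mem_insert_self j I
    have hmem : ∀ {i}, i ∈ I → i ∈ insert j I := fun hi => Finset.mem_insert_of_mem hi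
    rcases I.eq_empty_or_nonempty with rfl | hI
    · refine ⟨x j, fun i hi v _ => ?_⟩
      obtain rfl : i = j := by simpa using hi
      simpa using hB.zero_mem v
    have hzj := hz j hjI
    -- The tolerance is tightened to `t * z i`, leaving room for adding the correction term.
    obtain ⟨b, hb⟩ := ih (fun i hi => hSne i (hmem hi)) (fun i => t * z i)
      (fun i hi => mul_ne_zero ht (hz i (hmem hi)))
      (fun i hi k hk hik v hv w hw => by
        obtain ⟨A, hA, htA, hx, hzz⟩ := h i (hmem hi) k (hmem hk) hik v hv w hw
        refine ⟨A, hA, htA, ?_, ?_⟩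
        · convert A.mul_mem _ _ htA hx using 1
          rw [mul_inv]
          ring
        · convert hzz using 1
          have := hz k (hmem hk)
          field_simp)
    obtain ⟨y, hy⟩ : ∃ y, y = x j - b := ⟨_, rfl⟩
    have hQ : Q.Nonempty := (hSne j hjI).mono (hSQ j)
    -- In the margin `s = c * d`, `c` secures `(t * s)⁻¹` in the ball and `d` absorbs the error on
    -- `S j`; `t⁻¹ ^ 3` anticipates the losses in the cutoff.
    obtain ⟨c, hc0, hc⟩ := hf.exists_dominating hQ (t⁻¹)
    obtain ⟨d, hd0, hd⟩ := hf.exists_dominating hQ (t⁻¹ ^ 3 * (y * (z j)⁻¹))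
    obtain ⟨E, hE0, hET, hES⟩ := hf.exists_large hB hopen S hS hSQ (hS j) (hSne j hjI) (hSQ j)
      I hI (fun i hi => hSne i (hmem hi)) (fun i => t⁻¹ ^ 3 * (y * (z i)⁻¹)) (c * d)
      (mul_ne_zero hc0 hd0)
      (fun v hv => by
        rw [mul_inv]
        exact v.mul_mem (hc v hv).1 (hd v hv).1)
      (fun v hv => by
        convert v.mul_mem (hc v hv).2.1 (hd v hv).1 using 1
        field_simp)
      (fun i hi v hv w hw => by
        obtain ⟨A, hA, htA, hx, hzz⟩ := h i (hmem hi) j hjI (fun hij => hj (hij ▸ hi)) v hv w hw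
        -- Modulo `z i * A`, `b` agrees with `x i`, which agrees with `x j` by (I); hence `y = x j -
        -- b` lies in `z i * A`.
        have hyi : y * (z i)⁻¹ ∈ A := by
          have h1 : (b - x i) * (z i)⁻¹ ∈ A := by
            refine hA.1 ?_
            convert v.mul_mem (hf.mem (hSQ i hv)) (hB.subset v (hb i hi v hv)) using 1
            field_simp
          convert A.neg_mem _ (A.add_mem _ _ h1 hx) using 1
          rw [hy]
          ring
        have hyj : y * (z j)⁻¹ ∈ A := by
          convert A.mul_mem _ _ hyi hzz using 1
          have := hz i (hmem hi)
          field_simp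
        have ht3 : t⁻¹ ^ 3 ∈ A := _root_.pow_mem htA 3
        exact ⟨A, hA, htA, A.mul_mem _ _ ((hc v (hSQ i hv)).2.2 A hA.1 htA htA)
          ((hd v (hSQ i hv)).2.2 A hA.1 htA (A.mul_mem _ _ ht3 hyj)), A.mul_mem _ _ ht3 hyi⟩)
    -- `E` is small on `S j` and large on the other sets, so the cutoff is taken at `E⁻¹`.
    obtain ⟨g, hg⟩ := hf.exists_cutoff (inv_ne_zero hE0)
    refine ⟨b + g * y, fun i hi v hv => ?_⟩
    have hvQ := hSQ i hv
    have htv := hf.mem hvQ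
    rcases Finset.mem_insert.1 hi with rfl | hi'
    · have hEB : E ∈ B v := by
        convert hB.mul_mem v _ (v.mul_mem (hc v hvQ).1 (hd v hvQ).1) _ (hET v hv) using 1
        field_simp
      have h1 := (hg v hvQ).1 (by simpa using hB.subset v hEB)
      -- On `S j` the error is `b + g * y - x j = (g - 1) * y`.
      convert hB.mul_mem v _ (v.mul_mem (v.mul_mem h1 (hd v hvQ).2.1) (hc v hvQ).1) _
        (hET v hv) using 1
      rw [hy]
      field_simp
      ring
    · have hzi := hz i hi
      obtain ⟨h1, h2⟩ := hES i hi' v hv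
      have h3 := hB.mul_mem v _ ((hg v hvQ).2 h1) _ h2
      convert hB.add_mem v hvQ _ (hb i hi' v hv) _ h3 using 1
      field_simp
      ring

/-- Empty sets impose nothing and are discarded. For the others, (I) is applied with `w` the ring
`A`, which has refinements in both sets. -/
theorem IsUniform.exists_approximation_of_compact [TopologicalSpace (Locality K)]
    (hf : IsUniform f t Q) (hB : IsBallSystem t Q B) (hopen : ∀ x : K, IsOpen {v | x ∈ B v})
    {ι : Type*} [Fintype ι] (S : ι → Set (Locality K)) (hS : ∀ i, IsCompact (S i))
    (hSQ : ∀ i, S i ⊆ Q) (x z : ι → K) (hz : ∀ i, z i ≠ 0)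
    (hI : ∀ i j, ∀ w : ValuationSubring K,
      (∃ v ∈ S i, v ≤ Locality.ofValuation w) → (∃ v ∈ S j, v ≤ Locality.ofValuation w) →
        w.valuation (x i - x j) ≤ w.valuation (z i) ∧ w.valuation (z i) = w.valuation (z j))
    (h : ∀ i j, i ≠ j → ∀ v ∈ S i, ∀ w ∈ S j, ∃ A : ValuationSubring K,
      Splits B v w A ∧ t⁻¹ ∈ A) :
    ∃ a : K, ∀ i, ∀ v ∈ S i, a - x i ∈ z i • B v := by
  classical
  obtain ⟨a, ha⟩ := hf.exists_approximation hB hopen S hS hSQ x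
    (Finset.univ.filter fun i => (S i).Nonempty) (by simp) z (fun i _ => hz i)
    (fun i _ j _ hij v hv w hw => by
      obtain ⟨A, hA, htA⟩ := h i j hij v hv w hw
      obtain ⟨h1, h2⟩ := hI i j A ⟨v, hv, hA.1⟩ ⟨w, hw, hA.2.1⟩
      refine ⟨A, hA, htA, ?_, ?_⟩
      · rw [← A.valuation_le_one_iff, map_mul, map_inv₀]
        exact mul_inv_le_one_of_le₀ h1 zero_le
      · rw [← A.valuation_le_one_iff, map_mul, map_inv₀]
        exact mul_inv_le_one_of_le₀ h2.le zero_le)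
  refine ⟨a, fun i v hv => ?_⟩
  rw [Set.mem_smul_set_iff_inv_smul_mem₀ (hz i), smul_eq_mul, mul_comm]
  exact ha i (by simpa using ⟨v, hv⟩) v hv

end Locality

/-! ### The two situations. -/

theorem mainTheorem1 {K : Type*} [Field K] (n : ℕ) (S : Fin n → Set (Locality K))
    (t : K) (ht : t ≠ 0) (x z : Fin n → K) (hz : ∀ i, z i ≠ 0)
    (hU : Locality.Uniformity (⋃ i, S i) t)
    (hI : ∀ i j, ∀ w : ValuationSubring K,
      (∃ v ∈ S i, v ≤ Locality.ofValuation w) → (∃ v ∈ S j, v ≤ Locality.ofValuation w) →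
        w.valuation (x i - x j) ≤ w.valuation (z i) ∧ w.valuation (z i) = w.valuation (z j))
    (hind : ∀ i j, i ≠ j → ∀ v ∈ S i, ∀ w ∈ S j, Locality.TIndependent t v w) :
    ((∀ i, @IsCompact _ (Locality.zariskiDual K) (S i)) →
      (∀ i j, i ≠ j → ∀ v ∈ S i, ∀ w ∈ S j, Locality.Incomparable v w) →
        ∃ a : K, ∀ i, ∀ v ∈ S i, a - x i ∈ z i • v.maximal) ∧
    ((∀ i, @IsCompact _ (Locality.zariski K) (S i)) →
        ∃ a : K, ∀ i, ∀ v ∈ S i, a - x i ∈ z i • v.unitBall) := by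
  obtain ⟨f, hf⟩ := hU.exists_isUniform ht
  have hQ : ∀ i, S i ⊆ ⋃ i, S i := Set.subset_iUnion S
  have hring : ∀ i j, i ≠ j → ∀ v ∈ S i, ∀ w ∈ S j,
      ∃ A : ValuationSubring K, t⁻¹ ∈ A ∧ (A : Set K) = v.unitBall * w.unitBall := by
    intro i j hij v hv w hw
    obtain ⟨_, _, hadd⟩ := hU
    exact (hind i j hij v hv w hw).exists_valuationSubring (hadd v (hQ i hv)).2.2.2
      (hadd w (hQ j hw)).2.2.2
  constructor
  · intro hS hinc
    let : TopologicalSpace (Locality K) := Locality.zariskiDual K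
    refine hf.exists_approximation_of_compact hf.isBallSystem_maximal (fun y => ?_) S hS hQ x z hz
      hI fun i j hij v hv w hw => ?_
    · exact isOpen_induced (t := BallSet.zariskiDual K)
        (TopologicalSpace.isOpen_generateFrom_of_mem ⟨y, rfl⟩)
    · obtain ⟨A, htA, hA⟩ := hring i j hij v hv w hw
      exact ⟨A, Locality.splits_maximal hA (hinc i j hij v hv w hw), htA⟩
  · intro hS
    let : TopologicalSpace (Locality K) := Locality.zariski K
    refine hf.exists_approximation_of_compact hf.isBallSystem_unitBall (fun y => ?_) S hS hQ x z hz
      hI fun i j hij v hv w hw => ?_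
    · exact isOpen_induced (t := BallSet.zariski K)
        (TopologicalSpace.isOpen_generateFrom_of_mem ⟨y, rfl⟩)
    · obtain ⟨A, htA, hA⟩ := hring i j hij v hv w hw
      exact ⟨A, Locality.splits_unitBall hA, htA⟩
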